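/- Let $\mathcal H$ be a complex Hilbert space. Write $A>0$ if $A$ is a bounded positive invertible operator on $\mathcal H$, let $B(\mathcal H)^{++}$ be the set of these operators, and let $\le$ be the usual (Loewner) order of self-adjoint operators. A continuous function $f:(0,\infty)\to\mathbb R$ is operator monotone if $0<A\le B$ implies $f(A)\le f(B)$ for bounded operators $A,B$ on any complex Hilbert space. Let $\mathrm{OM}_+^1$ be the set of operator monotone functions $h$ on $(0,\infty)$ with $h>0$ and $h(1)=1$. A function $h:(0,\infty)\to(0,\infty)$ is power monotone decreasing (pmd) if $h(t^p)\le h(t)^p$ for all $t>0$ and $p\ge1$. For $A,B>0$, $h\in\mathrm{OM}_+^1$ and $\alpha\in(0,1)$ put $$A\,\sigma_h B:=A^{1/2}h(A^{-1/2}BA^{-1/2})A^{1/2},\qquad A\,\#_\alpha B:=A^{1/2}(A^{-1/2}BA^{-1/2})^{\alpha}A^{1/2}.$$ Proposition 5.9. Let $\alpha\in(0,1)$ and let $\mathrm{PMD}_\alpha^1$ be the set of all $h\in\mathrm{OM}_+^1$ such that $h$ is pmd and $h'(1)=\alpha$. Then for any $A,B\in B(\mathcal H)^{++}$ the following conditions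 are equivalent, where a map $F:[0,\infty)\to B(\mathcal H)^{++}$ is called decreasing if $F(y)\le F(x)$ whenever $0\le x\le y$: (i) $(1-\alpha)\log A+\alpha\log B\le 0$; (ii) $x\mapsto A^x\sigma_h B^x$ is a decreasing map from $[0,\infty)$ into $B(\mathcal H)^{++}$ for all $h\in\mathrm{PMD}_\alpha^1$; (iii) $x\mapsto A^x\sigma_h B^x$ is a decreasing map from $[0,\infty)$ into $B(\mathcal H)^{++}$ for some $h\in\mathrm{PMD}_\alpha^1$; (iv) $x\mapsto A^x\#_\alpha B^x$ is a decreasing map from $[0,\infty)$ into $B(\mathcal H)^{++}$. -/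

import Mathlib

open Set

/-- A real function `f` on `(0,∞)` is operator monotone if it is continuous there and
`0 < A ≤ B` implies `f(A) ≤ f(B)` for all bounded operators on all complex Hilbert spaces.
Functions on `(0,∞)` are represented by functions `ℝ → ℝ` whose values outside `(0,∞)` are
irrelevant, since positive invertible operators have spectrum in `(0,∞)`. -/
def IsOperatorMonotone.{u} (f : ℝ → ℝ) : Prop :=
  ContinuousOn f (Ioi 0) ∧
    ∀ (K : Type u) [NormedAddCommGroup K] [InnerProductSpace ℂ K] [CompleteSpace K]
      (A B : K →L[ℂ] K), IsStrictlyPositive A → A ≤ B → cfc f A ≤ cfc f B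

/-- The class `OM₊¹`: positive operator monotone functions `h` on `(0,∞)` with `h(1) = 1`. -/
def OMPlusOne.{u} : Set (ℝ → ℝ) :=
  {h | IsOperatorMonotone.{u} h ∧ (∀ t, 0 < t → 0 < h t) ∧ h 1 = 1}

/-- Power monotone decreasing: `f(t ^ p) ≤ f(t) ^ p` for all `t > 0` and `p ≥ 1`. -/
def IsPMD (f : ℝ → ℝ) : Prop :=
  ∀ t p : ℝ, 0 < t → 1 ≤ p → f (t ^ p) ≤ f t ^ p

/-- The class `PMD_α¹` of all pmd functions `h` in `OM₊¹` with `h'(1) = α`. -/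
def PMDOne.{u} (α : ℝ) : Set (ℝ → ℝ) :=
  {h | h ∈ OMPlusOne.{u} ∧ IsPMD h ∧ HasDerivAt h α 1}

section OperatorMeans

variable {H : Type*} [NormedAddCommGroup H] [InnerProductSpace ℂ H] [CompleteSpace H]

/-- The operator perspective `P_f(A,B) = B^{1/2} f(B^{-1/2} A B^{-1/2}) B^{1/2}`, for positive
invertible `A` and `B`. -/
noncomputable def operatorPerspective (f : ℝ → ℝ) (A B : H →L[ℂ] H) : H →L[ℂ] H :=
  B ^ (1 / 2 : ℝ) * cfc f (B ^ (-(1 / 2) : ℝ) * A * B ^ (-(1 / 2) : ℝ)) * B ^ (1 / 2 : ℝ)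

/-- The operator mean `A σ_h B = P_h(B,A)`, for positive invertible `A` and `B`. -/
noncomputable def operatorMean (h : ℝ → ℝ) (A B : H →L[ℂ] H) : H →L[ℂ] H :=
  operatorPerspective h B A

/-- The weighted geometric mean `A #_α B = A^{1/2} (A^{-1/2} B A^{-1/2})^α A^{1/2}`, for positive
invertible `A` and `B`. -/
noncomputable def weightedGeometricMean (α : ℝ) (A B : H →L[ℂ] H) : H →L[ℂ] H :=
  A ^ (1 / 2 : ℝ) * (A ^ (-(1 / 2) : ℝ) * B * A ^ (-(1 / 2) : ℝ)) ^ α * A ^ (1 / 2 : ℝ)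

/-- `F` restricts to a decreasing (order reversing, not necessarily strictly) map from `[0,∞)`
into the set of positive invertible operators. -/
def IsDecreasingIntoPositive (F : ℝ → H →L[ℂ] H) : Prop :=
  MapsTo F (Ici 0) {X | IsStrictlyPositive X} ∧ AntitoneOn F (Ici 0)

end OperatorMeans

universe u

/-! ### Continuous functional calculus and intertwining operators. -/

section FunctionalCalculus

open Filter Topology
open scoped InnerProduct

variable {H G : Type*} [NormedAddCommGroup H] [InnerProductSpace ℂ H]
  [NormedAddCommGroup G] [InnerProductSpace ℂ G]

/-! Put `F x = A^x σ_h B^x`. Then `F 0 = 1` and `F` has derivative `(1-α) log A + α log B` at `0`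
(`hasDerivAt_operatorMean_rpow`), so a decreasing `F` makes this derivative nonpositive. As `t ^ α`
lies in the class, only (i) ⇒ (ii) is hard.

It rests on an Ando–Hiai estimate (`operatorMean_rpow_rpow_le`): `F 1 ≤ c` implies `F p ≤ c^(p-1) F
1` for `1 ≤ p ≤ 2`. With `C = A^(-1/2) B A^(-1/2)` the hypothesis says `A ≤ c h(C)⁻¹`. Löwner–Heinz
with exponent `p - 1` then bounds both `A^(p-1)` and `A^(-1/2) B^p A^(-1/2)` by functions of `C`.
Joint monotonicity of the mean reduces the claim to a scalar inequality, which is pmd. Joint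
monotonicity comes from Hansen's inequality, itself obtained by dilation from Jensen's inequality
for isometries.

Under (i), `F x ≤ exp (ε x)` for small `x`. The estimate with `p = 2` carries this bound from `x` to
`2x`, hence to every `x`, and `ε → 0` gives `F ≤ 1`. The estimate with `c = 1` then says that `F`
decreases. -/

theorem aeval_comp_of_intertwines {S : G →L[ℂ] G} {Y : H →L[ℂ] H} {V : H →L[ℂ] G}
    (h : S ∘L V = V ∘L Y) (p : Polynomial ℝ) :
    (Polynomial.aeval S p) ∘L V = V ∘L (Polynomial.aeval Y p) := by
  have hpow : ∀ n : ℕ, (S ^ n) ∘L V = V ∘L (Y ^ n) := by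
    intro n
    induction n with
    | zero => ext x; simp
    | succ n ih =>
      ext x
      have h1 := congrArg (fun L => L (Y x)) ih
      have h2 := congrArg (fun L => (S ^ n) (L x)) h
      simp only [ContinuousLinearMap.comp_apply] at h1 h2
      simp only [ContinuousLinearMap.comp_apply, pow_succ, ContinuousLinearMap.mul_def]
      rw [h2, h1]
  induction p using Polynomial.induction_on' with
  | add p q hp hq =>
    rw [map_add, map_add, ContinuousLinearMap.add_comp, ContinuousLinearMap.comp_add, hp, hq]
  | monomial n a =>
    rw [Polynomial.aeval_monomial, Polynomial.aeval_monomial, ← Algebra.smul_def,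
      ← Algebra.smul_def, ContinuousLinearMap.smul_comp, hpow]
    ext x
    simp

variable [CompleteSpace H] [CompleteSpace G]

theorem IsStrictlyPositive.spectrum_subset_Ioi {A : H →L[ℂ] H} (hA : IsStrictlyPositive A) :
    spectrum ℝ A ⊆ Ioi 0 := fun _ hx => hA.spectrum_pos hx

theorem isStrictlyPositive_cfc {A : H →L[ℂ] H} (hA : IsStrictlyPositive A) {f : ℝ → ℝ}
    (hf : ContinuousOn f (Ioi 0)) (hpos : ∀ t, 0 < t → 0 < f t) :
    IsStrictlyPositive (cfc f A) :=
  (cfc_isStrictlyPositive_iff f A (hf.mono hA.spectrum_subset_Ioi) hA.isSelfAdjoint).2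
    fun _ hx => hpos _ (hA.spectrum_pos hx)

theorem continuousOn_cfc_isStrictlyPositive {f : ℝ → ℝ} (hf : ContinuousOn f (Ioi 0)) :
    ContinuousOn (fun A : H →L[ℂ] H => cfc f A) {A | IsStrictlyPositive A} := by
  refine continuousOn_id.cfc_of_mem_nhdsSet f (s := Ioi 0) ?_ (fun A hA => hA.isSelfAdjoint) hf
  rw [isOpen_Ioi.mem_nhdsSet]
  exact iUnion₂_subset fun A hA => hA.spectrum_subset_Ioi

theorem exists_polynomial_near_of_isCompact {s : Set ℝ} (hs : IsCompact s) {f : ℝ → ℝ}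
    (hf : ContinuousOn f s) {ε : ℝ} (hε : 0 < ε) :
    ∃ p : Polynomial ℝ, ∀ x ∈ s, |f x - p.eval x| < ε := by
  have : CompactSpace s := isCompact_iff_compactSpace.1 hs
  let F : C(s, ℝ) := ⟨s.domRestrict f, hf.domRestrict⟩
  have hF : F ∈ (polynomialFunctions s).topologicalClosure := by
    rw [polynomialFunctions.topologicalClosure]; trivial
  obtain ⟨g, hg, hd⟩ := Metric.mem_closure_iff.1 hF ε hε
  obtain ⟨p, -, rfl⟩ := hg
  refine ⟨p, fun x hx => ?_⟩
  exact (ContinuousMap.dist_apply_le_dist (f := F) (g := _) (⟨x, hx⟩ : s)).trans_lt hd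

/-- The continuous functional calculus respects intertwining operators. -/
theorem cfc_comp_of_intertwines {S : G →L[ℂ] G} {Y : H →L[ℂ] H} {V : H →L[ℂ] G}
    (hS : IsSelfAdjoint S) (hY : IsSelfAdjoint Y) (h : S ∘L V = V ∘L Y) {f : ℝ → ℝ}
    (hf : ContinuousOn f (spectrum ℝ S ∪ spectrum ℝ Y)) :
    (cfc f S) ∘L V = V ∘L (cfc f Y) := by
  have hK : IsCompact (spectrum ℝ S ∪ spectrum ℝ Y) :=
    (ContinuousFunctionalCalculus.isCompact_spectrum S).union
      (ContinuousFunctionalCalculus.isCompact_spectrum Y)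
  have hfS := hf.mono subset_union_left
  have hfY := hf.mono subset_union_right
  rw [← sub_eq_zero, ← norm_le_zero_iff]
  refine le_of_forall_pos_le_add fun ε hε => ?_
  -- Two error terms, each at most `‖V‖` times the approximation error; the `+ 1` covers `V = 0`.
  have hc : 0 < 2 * (‖V‖ + 1) := by positivity
  obtain ⟨p, hp⟩ := exists_polynomial_near_of_isCompact hK hf (div_pos hε hc)
  have hSn : ‖cfc f S - Polynomial.aeval S p‖ ≤ ε / (2 * (‖V‖ + 1)) := by
    rw [← cfc_polynomial p S hS, ← cfc_sub f p.eval S hfS (by fun_prop)]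
    exact norm_cfc_le (by positivity) fun x hx => (hp x (Or.inl hx)).le
  have hYn : ‖cfc f Y - Polynomial.aeval Y p‖ ≤ ε / (2 * (‖V‖ + 1)) := by
    rw [← cfc_polynomial p Y hY, ← cfc_sub f p.eval Y hfY (by fun_prop)]
    exact norm_cfc_le (by positivity) fun x hx => (hp x (Or.inr hx)).le
  have key : (cfc f S) ∘L V - V ∘L (cfc f Y) =
      (cfc f S - Polynomial.aeval S p) ∘L V - V ∘L (cfc f Y - Polynomial.aeval Y p) := by
    rw [ContinuousLinearMap.sub_comp, ContinuousLinearMap.comp_sub, aeval_comp_of_intertwines h]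
    abel
  rw [key, zero_add]
  calc _ ≤ ε / (2 * (‖V‖ + 1)) * ‖V‖ + ‖V‖ * (ε / (2 * (‖V‖ + 1))) := by
        refine (norm_sub_le _ _).trans (add_le_add ?_ ?_)
        · exact (ContinuousLinearMap.opNorm_comp_le _ _).trans (by gcongr)
        · exact (ContinuousLinearMap.opNorm_comp_le _ _).trans (by gcongr)
    _ ≤ ε := by
        have : ε / (2 * (‖V‖ + 1)) * ‖V‖ + ‖V‖ * (ε / (2 * (‖V‖ + 1)))
          = ε * (‖V‖ / (‖V‖ + 1)) := by
          field_simp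
          ring
        rw [this]
        exact mul_le_of_le_one_right hε.le
          ((div_le_one (by positivity)).2 (by linarith))

end FunctionalCalculus

/-! ### Jensen's inequality for isometries. -/

section Jensen

open Filter Topology
open scoped InnerProduct

variable {H G : Type u} [NormedAddCommGroup H] [InnerProductSpace ℂ H] [CompleteSpace H]
  [NormedAddCommGroup G] [InnerProductSpace ℂ G] [CompleteSpace G]

theorem ContinuousLinearMap.adjoint_comp_comp_mono {S T : G →L[ℂ] G} (h : S ≤ T)
    (V : H →L[ℂ] G) : V† ∘L S ∘L V ≤ V† ∘L T ∘L V := by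
  rw [ContinuousLinearMap.le_def] at h ⊢
  have := h.adjoint_conj V
  rwa [ContinuousLinearMap.sub_comp, ContinuousLinearMap.comp_sub] at this

/-- Jensen's operator inequality for operator monotone functions and compressions by isometries. -/
theorem IsOperatorMonotone.adjoint_comp_cfc_comp_le {f : ℝ → ℝ} (hf : IsOperatorMonotone.{u} f)
    {T : G →L[ℂ] G} (hT : IsStrictlyPositive T) {V : H →L[ℂ] G} (hV : V† ∘L V = 1)
    (hVT : IsStrictlyPositive (V† ∘L T ∘L V)) :
    V† ∘L cfc f T ∘L V ≤ cfc f (V† ∘L T ∘L V) := by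
  set Y := V† ∘L T ∘L V with hYdef
  have hVapp : ∀ x, (V†) (V x) = x := fun x => by
    simpa using congrArg (fun L : H →L[ℂ] H => L x) hV
  set P : G →L[ℂ] G := V ∘L V† with hP
  set Q : G →L[ℂ] G := 1 - P with hQ
  have hPs : star P = P := by
    rw [ContinuousLinearMap.star_eq_adjoint, hP, ContinuousLinearMap.adjoint_comp,
      ContinuousLinearMap.adjoint_adjoint]
  have hQs : star Q = Q := by rw [hQ, star_sub, star_one, hPs]
  have hPV : ∀ x, P (V x) = V x := fun x => by simp [hP, hVapp]
  have step : ∀ δ : ℝ, 0 < δ → V† ∘L cfc f T ∘L V ≤ cfc f ((1 + δ ^ 2) • Y) := by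
    intro δ hδ
    -- `R` dominates `T` and is block diagonal for `P` and `Q`. The weights make `R - T` a
    -- congruence of `T`: the off-diagonal blocks match because `δ * δ⁻¹ = 1`, and the weight on the
    -- `P` block tends to `1`.
    set R : G →L[ℂ] G := (1 + δ ^ 2) • (P * T * P) + (1 + (δ⁻¹) ^ 2) • (Q * T * Q) with hR
    have hTR : T ≤ R := by
      rw [← sub_nonneg]
      have : R - T = star (δ • P - δ⁻¹ • Q) * T * (δ • P - δ⁻¹ • Q) := by
        have hT1 : T = (P + Q) * T * (P + Q) := by simp [hQ]
        rw [star_sub, star_smul, star_smul, hPs, hQs, hR]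
        nth_rw 3 [hT1]
        have hd : δ * δ⁻¹ = 1 := mul_inv_cancel₀ hδ.ne'
        have hd' : δ⁻¹ * δ = 1 := inv_mul_cancel₀ hδ.ne'
        simp only [star_trivial, add_mul, mul_add, sub_mul, mul_sub, smul_mul_assoc,
          mul_smul_comm, smul_smul, add_smul, one_smul, hd, hd', pow_two, smul_sub]
        abel
      rw [this]
      exact star_left_conjugate_nonneg hT.nonneg _
    have hRpos : IsStrictlyPositive R := hT.of_le hTR
    have hYpos : IsStrictlyPositive ((1 + δ ^ 2) • Y) := hVT.smul (by positivity)
    -- `Q` kills the range of `V`, so the large `Q` block does not enter.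
    have hRV : R ∘L V = V ∘L ((1 + δ ^ 2) • Y) := by
      ext x
      simp [hR, hQ, hYdef, hP, hVapp]
    have hcomp := cfc_comp_of_intertwines hRpos.isSelfAdjoint hYpos.isSelfAdjoint hRV
      (hf.1.mono (union_subset hRpos.spectrum_subset_Ioi hYpos.spectrum_subset_Ioi))
    calc _ ≤ V† ∘L cfc f R ∘L V :=
          ContinuousLinearMap.adjoint_comp_comp_mono (hf.2 G T R hT hTR) V
      _ = cfc f ((1 + δ ^ 2) • Y) := by
          rw [hcomp, ← ContinuousLinearMap.comp_assoc, hV]; rfl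
  have hlim : Tendsto (fun δ : ℝ => cfc f ((1 + δ ^ 2) • Y)) (𝓝[>] 0) (𝓝 (cfc f Y)) := by
    have h1 := (continuousOn_cfc_isStrictlyPositive (H := H) hf.1) Y hVT
    refine h1.tendsto.comp (tendsto_nhdsWithin_iff.2 ⟨?_, ?_⟩)
    · have : Continuous fun δ : ℝ => (1 + δ ^ 2) • Y := by fun_prop
      have h := this.tendsto 0
      simp only [ne_eq, OfNat.ofNat_ne_zero, not_false_eq_true, zero_pow, add_zero, one_smul] at h
      exact h.mono_left nhdsWithin_le_nhds
    · exact Eventually.of_forall fun δ => hVT.smul (by positivity)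
  refine ge_of_tendsto hlim ?_
  filter_upwards [self_mem_nhdsWithin] with δ hδ using step δ hδ

end Jensen

/-! ### Block operators on the doubled space. -/

section Block

open Filter Topology
open scoped InnerProduct

variable {H : Type*} [NormedAddCommGroup H] [InnerProductSpace ℂ H]

/-- The column operator `x ↦ (K x, D x)` into the Hilbert sum of two copies of `H`. -/
noncomputable def columnOperator (K D : H →L[ℂ] H) : H →L[ℂ] WithLp 2 (H × H) :=
  (WithLp.prodContinuousLinearEquiv 2 ℂ H H).symm.toContinuousLinearMap ∘L (K.prod D)

/-- The block diagonal operator on the Hilbert sum of two copies of `H`. -/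
noncomputable def blockDiagonalOperator (X Y : H →L[ℂ] H) :
    WithLp 2 (H × H) →L[ℂ] WithLp 2 (H × H) :=
  (WithLp.prodContinuousLinearEquiv 2 ℂ H H).symm.toContinuousLinearMap ∘L (X.prodMap Y) ∘L
    (WithLp.prodContinuousLinearEquiv 2 ℂ H H).toContinuousLinearMap

@[simp]
theorem columnOperator_apply (K D : H →L[ℂ] H) (x : H) :
    columnOperator K D x = WithLp.toLp 2 (K x, D x) := rfl

@[simp]
theorem blockDiagonalOperator_apply (X Y : H →L[ℂ] H) (g : WithLp 2 (H × H)) :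
    blockDiagonalOperator X Y g = WithLp.toLp 2 (X g.fst, Y g.snd) := rfl

theorem IsStrictlyPositive.blockDiagonalOperator {X Y : H →L[ℂ] H} (hX : IsStrictlyPositive X)
    (hY : IsStrictlyPositive Y) : IsStrictlyPositive (blockDiagonalOperator X Y) := by
  refine ⟨?_, ?_⟩
  · have hXp := (ContinuousLinearMap.nonneg_iff_isPositive X).1 hX.nonneg
    have hYp := (ContinuousLinearMap.nonneg_iff_isPositive Y).1 hY.nonneg
    rw [ContinuousLinearMap.nonneg_iff_isPositive]
    refine (ContinuousLinearMap.isPositive_iff_complex _).2 fun g => ?_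
    have h1 := (ContinuousLinearMap.isPositive_iff_complex _).1 hXp g.fst
    have h2 := (ContinuousLinearMap.isPositive_iff_complex _).1 hYp g.snd
    simp only [blockDiagonalOperator_apply, WithLp.prod_inner_apply]
    refine ⟨?_, ?_⟩
    · simp only [map_add, Complex.ofReal_add]
      exact congrArg₂ _ h1.1 h2.1
    · rw [map_add]
      exact _root_.add_nonneg h1.2 h2.2
  · obtain ⟨a, ha⟩ := hX.isUnit
    obtain ⟨b, hb⟩ := hY.isUnit
    have hab : ∀ x, X ((↑a⁻¹ : H →L[ℂ] H) x) = x := fun x => by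
      rw [← ha]; exact congrArg (fun L : H →L[ℂ] H => L x) a.mul_inv
    have hab' : ∀ x, (↑a⁻¹ : H →L[ℂ] H) (X x) = x := fun x => by
      rw [← ha]; exact congrArg (fun L : H →L[ℂ] H => L x) a.inv_mul
    have hbb : ∀ x, Y ((↑b⁻¹ : H →L[ℂ] H) x) = x := fun x => by
      rw [← hb]; exact congrArg (fun L : H →L[ℂ] H => L x) b.mul_inv
    have hbb' : ∀ x, (↑b⁻¹ : H →L[ℂ] H) (Y x) = x := fun x => by
      rw [← hb]; exact congrArg (fun L : H →L[ℂ] H => L x) b.inv_mul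
    refine isUnit_iff_exists.2 ⟨_root_.blockDiagonalOperator ↑a⁻¹ ↑b⁻¹, ?_, ?_⟩
    · exact ContinuousLinearMap.ext fun g =>
        WithLp.ofLp_injective 2 (Prod.ext (hab g.fst) (hbb g.snd))
    · exact ContinuousLinearMap.ext fun g =>
        WithLp.ofLp_injective 2 (Prod.ext (hab' g.fst) (hbb' g.snd))

variable [CompleteSpace H]

theorem adjoint_columnOperator_comp (K D X Y : H →L[ℂ] H) :
    (columnOperator K D)† ∘L blockDiagonalOperator X Y ∘L columnOperator K D =
      star K * X * K + star D * Y * D := by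
  ext x
  refine ext_inner_right ℂ fun y => ?_
  simp [ContinuousLinearMap.adjoint_inner_left, ContinuousLinearMap.star_eq_adjoint,
    inner_add_left, WithLp.prod_inner_apply]

/-- Each coordinate embedding intertwines a block with the diagonal operator, hence also their
functional calculi. -/
theorem cfc_blockDiagonalOperator {X Y : H →L[ℂ] H} (hX : IsStrictlyPositive X)
    (hY : IsStrictlyPositive Y) {f : ℝ → ℝ} (hf : ContinuousOn f (Ioi 0)) :
    cfc f (blockDiagonalOperator X Y) = blockDiagonalOperator (cfc f X) (cfc f Y) := by
  have hD := hX.blockDiagonalOperator hY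
  have h1 := cfc_comp_of_intertwines (V := columnOperator (1 : H →L[ℂ] H) 0) hD.isSelfAdjoint
    hX.isSelfAdjoint (by ext x; simp)
    (hf.mono (union_subset hD.spectrum_subset_Ioi hX.spectrum_subset_Ioi))
  have h2 := cfc_comp_of_intertwines (V := columnOperator (0 : H →L[ℂ] H) 1) hD.isSelfAdjoint
    hY.isSelfAdjoint (by ext x; simp)
    (hf.mono (union_subset hD.spectrum_subset_Ioi hY.spectrum_subset_Ioi))
  refine ContinuousLinearMap.ext fun g => ?_
  have hg : g = columnOperator (1 : H →L[ℂ] H) 0 g.fst + columnOperator (0 : H →L[ℂ] H) 1 g.snd := by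
    exact WithLp.ofLp_injective 2 (Prod.ext (by simp) (by simp))
  have e1 := congrArg (fun L : H →L[ℂ] WithLp 2 (H × H) => L g.fst) h1
  have e2 := congrArg (fun L : H →L[ℂ] WithLp 2 (H × H) => L g.snd) h2
  simp only [ContinuousLinearMap.comp_apply] at e1 e2
  conv_lhs => rw [hg, map_add, e1, e2]
  exact WithLp.ofLp_injective 2 (Prod.ext (by simp) (by simp))

end Block

/-! ### Hansen's inequality by dilation. -/

section Hansen

open Filter Topology

variable {H : Type u} [NormedAddCommGroup H] [InnerProductSpace ℂ H] [CompleteSpace H]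

/-- Jensen's operator inequality for operator monotone functions and operator convex
combinations. -/
theorem IsOperatorMonotone.conjugate_cfc_add_le {f : ℝ → ℝ} (hf : IsOperatorMonotone.{u} f)
    {X Y K D : H →L[ℂ] H} (hX : IsStrictlyPositive X) (hY : IsStrictlyPositive Y)
    (hKD : star K * K + star D * D = 1)
    (hpos : IsStrictlyPositive (star K * X * K + star D * Y * D)) :
    star K * cfc f X * K + star D * cfc f Y * D ≤ cfc f (star K * X * K + star D * Y * D) := by
  have h1 : ContinuousLinearMap.adjoint (columnOperator K D) ∘L columnOperator K D = 1 := by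
    have := adjoint_columnOperator_comp K D 1 1
    rw [mul_one, mul_one, hKD] at this
    rw [← this]
    ext x; simp
  have := hf.adjoint_comp_cfc_comp_le (hX.blockDiagonalOperator hY) h1
    (by rwa [adjoint_columnOperator_comp])
  rwa [cfc_blockDiagonalOperator hX hY hf.1, adjoint_columnOperator_comp,
    adjoint_columnOperator_comp] at this

/-- Hansen's inequality for positive operator monotone functions and invertible contractions. -/
theorem IsOperatorMonotone.conjugate_cfc_le {f : ℝ → ℝ} (hf : IsOperatorMonotone.{u} f)
    (hf0 : ∀ t, 0 < t → 0 < f t) {X K : H →L[ℂ] H} (hX : IsStrictlyPositive X)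
    (hK : IsUnit K) (hK1 : star K * K ≤ 1) :
    star K * cfc f X * K ≤ cfc f (star K * X * K) := by
  have hY : IsStrictlyPositive (star K * X * K) :=
    hK.isStrictlyPositive_star_left_conjugate_iff.2 hX
  -- `D` completes the contraction `K` to an isometric column.
  obtain ⟨D, hD⟩ := CStarAlgebra.nonneg_iff_eq_star_mul_self.1 (sub_nonneg.2 hK1)
  have hKD : star K * K + star D * D = 1 := by rw [← hD]; abel
  have hpos : ∀ s : ℝ, 0 < s → IsStrictlyPositive (star K * X * K + s • (star D * D)) :=
    fun s hs => hY.add_nonneg (smul_nonneg hs.le (star_mul_self_nonneg D))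
  -- The second block is the scalar `s > 0` rather than `0`, where `f` is not controlled. Positivity
  -- of `f s` lets its term be dropped.
  have step : ∀ s : ℝ, 0 < s →
      star K * cfc f X * K ≤ cfc f (star K * X * K + s • (star D * D)) := by
    intro s hs
    have hs1 : IsStrictlyPositive (algebraMap ℝ (H →L[ℂ] H) s) := isStrictlyPositive_algebraMap hs
    have hconj : ∀ r : ℝ, star D * algebraMap ℝ (H →L[ℂ] H) r * D = r • (star D * D) := fun r => by
      rw [← Algebra.commutes, mul_assoc, Algebra.smul_def]
    have := hf.conjugate_cfc_add_le hX hs1 hKD (by rw [hconj]; exact hpos s hs)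
    rw [hconj, cfc_algebraMap, hconj] at this
    exact le_trans (le_add_of_nonneg_right
      (smul_nonneg (hf0 s hs).le (star_mul_self_nonneg D))) this
  have hlim : Tendsto (fun s : ℝ => cfc f (star K * X * K + s • (star D * D))) (𝓝[>] 0)
      (𝓝 (cfc f (star K * X * K))) := by
    refine ((continuousOn_cfc_isStrictlyPositive (H := H) hf.1) _ hY).tendsto.comp
      (tendsto_nhdsWithin_iff.2 ⟨?_, ?_⟩)
    · have : Continuous fun s : ℝ => star K * X * K + s • (star D * D) := by fun_prop
      have h := this.tendsto 0
      rw [zero_smul, add_zero] at h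
      exact h.mono_left nhdsWithin_le_nhds
    · filter_upwards [self_mem_nhdsWithin] with s hs using hpos s hs
  refine ge_of_tendsto hlim ?_
  filter_upwards [self_mem_nhdsWithin] with s hs using step s hs

end Hansen

/-! ### Real powers and congruences. -/

section Powers

variable {H : Type*} [NormedAddCommGroup H] [InnerProductSpace ℂ H] [CompleteSpace H]

theorem IsStrictlyPositive.rpow_rpow {A : H →L[ℂ] H} (hA : IsStrictlyPositive A) (x y : ℝ) :
    (A ^ x) ^ y = A ^ (x * y) := by
  rcases eq_or_ne x 0 with rfl | hx
  · rw [CFC.rpow_zero A hA.nonneg, CFC.one_rpow, zero_mul, CFC.rpow_zero A hA.nonneg]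
  · exact CFC.rpow_rpow A x y hx hA

theorem isSelfAdjoint_rpow (A : H →L[ℂ] H) (x : ℝ) : IsSelfAdjoint (A ^ x) :=
  (CFC.rpow_nonneg (a := A) (y := x)).isSelfAdjoint

theorem IsStrictlyPositive.rpow_conjugate {A B : H →L[ℂ] H} (hA : IsStrictlyPositive A)
    (hB : IsStrictlyPositive B) (x : ℝ) : IsStrictlyPositive (A ^ x * B * A ^ x) :=
  hB.conjugate_of_isUnit_of_isSelfAdjoint _ _ (hA.rpow A x).isUnit (isSelfAdjoint_rpow A x)

theorem IsStrictlyPositive.rpow_half_mul_rpow_half {A : H →L[ℂ] H} (hA : IsStrictlyPositive A) :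
    A ^ (1 / 2 : ℝ) * A ^ (1 / 2 : ℝ) = A := by
  rw [← CFC.rpow_add hA.isUnit, add_halves, CFC.rpow_one A hA.nonneg]

theorem continuousOn_rpow_Ioi (p : ℝ) : ContinuousOn (fun t : ℝ => t ^ p) (Ioi 0) :=
  continuousOn_id.rpow_const fun _ ht => Or.inl (ne_of_gt ht)

theorem cfc_conjugate_cfc {f g : ℝ → ℝ} {C : H →L[ℂ] H} (hf : ContinuousOn f (spectrum ℝ C))
    (hg : ContinuousOn g (spectrum ℝ C)) :
    cfc f C * cfc g C * cfc f C = cfc (fun t => f t * g t * f t) C := by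
  rw [cfc_mul (fun t => f t * g t) f C (hf.mul hg) hf, cfc_mul f g C hf hg]

theorem IsStrictlyPositive.rpow_half_conjugate_cfc {C : H →L[ℂ] H} (hC : IsStrictlyPositive C)
    {g : ℝ → ℝ} (hg : ContinuousOn g (spectrum ℝ C)) :
    C ^ (1 / 2 : ℝ) * cfc g C * C ^ (1 / 2 : ℝ) = cfc (fun t => t * g t) C := by
  rw [CFC.rpow_eq_cfc_real hC.nonneg,
    cfc_conjugate_cfc ((continuousOn_rpow_Ioi _).mono hC.spectrum_subset_Ioi) hg]
  refine cfc_congr fun t ht => ?_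
  rw [mul_right_comm, ← Real.rpow_add (hC.spectrum_pos ht), add_halves, Real.rpow_one]

/-- `Z` intertwines `Z * star Z` with `star Z * Z`. This lets a power of `B = Z * star Z` be
rewritten through a power of `star Z * Z`. -/
theorem mul_star_self_rpow_mul {Z : H →L[ℂ] H} (hZ : IsUnit Z) (q : ℝ) :
    (Z * star Z) ^ q * Z = Z * (star Z * Z) ^ q := by
  have h1 : IsStrictlyPositive (Z * star Z) :=
    CStarAlgebra.isStrictlyPositive_iff_eq_mul_star_self.2 ⟨Z, hZ, rfl⟩
  have h2 : IsStrictlyPositive (star Z * Z) :=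
    CStarAlgebra.isStrictlyPositive_iff_eq_star_mul_self.2 ⟨Z, hZ, rfl⟩
  rw [CFC.rpow_eq_cfc_real h1.nonneg, CFC.rpow_eq_cfc_real h2.nonneg]
  exact cfc_comp_of_intertwines h1.isSelfAdjoint h2.isSelfAdjoint (mul_assoc Z (star Z) Z)
    ((continuousOn_rpow_Ioi q).mono (union_subset h1.spectrum_subset_Ioi h2.spectrum_subset_Ioi))

theorem conjugate_le_conjugate_of_isSelfAdjoint {A B C : H →L[ℂ] H} (h : A ≤ B)
    (hC : IsSelfAdjoint C) : C * A * C ≤ C * B * C := by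
  have := star_left_conjugate_le_conjugate h C
  rwa [hC.star_eq] at this

end Powers

/-! ### Algebra of operator means. -/

section Mean

variable {H : Type*} [NormedAddCommGroup H] [InnerProductSpace ℂ H] [CompleteSpace H]

theorem operatorMean_eq (h : ℝ → ℝ) (A B : H →L[ℂ] H) :
    operatorMean h A B = A ^ (1 / 2 : ℝ) * cfc h (A ^ (-(1 / 2) : ℝ) * B * A ^ (-(1 / 2) : ℝ)) *
      A ^ (1 / 2 : ℝ) := rfl

theorem weightedGeometricMean_eq_operatorMean (α : ℝ) {A B : H →L[ℂ] H}
    (hA : IsStrictlyPositive A) (hB : IsStrictlyPositive B) :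
    weightedGeometricMean α A B = operatorMean (fun t => t ^ α) A B := by
  rw [weightedGeometricMean, operatorMean_eq,
    CFC.rpow_eq_cfc_real (hA.rpow_conjugate hB _).nonneg]

theorem isStrictlyPositive_operatorMean {h : ℝ → ℝ} (hc : ContinuousOn h (Ioi 0))
    (hpos : ∀ t, 0 < t → 0 < h t) {A B : H →L[ℂ] H}
    (hA : IsStrictlyPositive A) (hB : IsStrictlyPositive B) :
    IsStrictlyPositive (operatorMean h A B) :=
  hA.rpow_conjugate (isStrictlyPositive_cfc (hA.rpow_conjugate hB _) hc hpos) _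

/-- The mean of two functions of the same operator. -/
theorem operatorMean_cfc_cfc {h u v : ℝ → ℝ} (hh : ContinuousOn h (Ioi 0))
    (hu : ContinuousOn u (Ioi 0)) (hu0 : ∀ t, 0 < t → 0 < u t)
    (hv : ContinuousOn v (Ioi 0)) (hv0 : ∀ t, 0 < t → 0 < v t)
    {C : H →L[ℂ] H} (hC : IsStrictlyPositive C) :
    operatorMean h (cfc u C) (cfc v C) = cfc (fun t => u t * h (v t / u t)) C := by
  have hs := hC.spectrum_subset_Ioi
  have hup : ∀ p : ℝ, ContinuousOn (fun t => u t ^ p) (spectrum ℝ C) := fun p =>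
    (hu.mono hs).rpow_const fun t ht => Or.inl (hu0 t (hs ht)).ne'
  have hr : ∀ p : ℝ, cfc u C ^ p = cfc (fun t => u t ^ p) C := fun p =>
    CFC.cfc_rpow (fun t ht => hu0 t (hs ht)) (hu.mono hs) hC.isSelfAdjoint
  have hvu : ContinuousOn (fun t => v t / u t) (spectrum ℝ C) :=
    (hv.mono hs).div (hu.mono hs) fun t ht => (hu0 t (hs ht)).ne'
  have hinner : cfc (fun t => u t ^ (-(1 / 2) : ℝ)) C * cfc v C *
      cfc (fun t => u t ^ (-(1 / 2) : ℝ)) C = cfc (fun t => v t / u t) C := by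
    rw [cfc_conjugate_cfc (hup _) (hv.mono hs)]
    refine cfc_congr fun t ht => ?_
    have h0 := hu0 t (hs ht)
    have : u t ^ (-(1 / 2) : ℝ) * u t ^ (-(1 / 2) : ℝ) = (u t)⁻¹ := by
      rw [← Real.rpow_add h0, ← Real.rpow_neg_one]; norm_num
    rw [mul_right_comm, this, div_eq_mul_inv, mul_comm]
  have hmaps : (fun t => v t / u t) '' spectrum ℝ C ⊆ Ioi 0 := by
    rintro _ ⟨t, ht, rfl⟩
    exact div_pos (hv0 t (hs ht)) (hu0 t (hs ht))
  have hcomp : ContinuousOn (fun t => h (v t / u t)) (spectrum ℝ C) :=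
    hh.comp hvu fun t ht => hmaps ⟨t, ht, rfl⟩
  rw [operatorMean_eq, hr, hr, hinner, ← cfc_comp' h _ C (hh.mono hmaps) hvu hC.isSelfAdjoint,
    cfc_conjugate_cfc (hup _) hcomp]
  refine cfc_congr fun t ht => ?_
  have h0 := hu0 t (hs ht)
  rw [mul_right_comm, ← Real.rpow_add h0, add_halves, Real.rpow_one]

/-- Splitting off a power of the first argument by a congruence. -/
theorem operatorMean_rpow_left (h : ℝ → ℝ) {A : H →L[ℂ] H} (hA : IsStrictlyPositive A)
    (B : H →L[ℂ] H) (p : ℝ) :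
    operatorMean h (A ^ p) B = A ^ (1 / 2 : ℝ) *
      operatorMean h (A ^ (p - 1)) (A ^ (-(1 / 2) : ℝ) * B * A ^ (-(1 / 2) : ℝ)) *
      A ^ (1 / 2 : ℝ) := by
  have e1 : A ^ (p * (1 / 2)) = A ^ (1 / 2 : ℝ) * A ^ ((p - 1) * (1 / 2)) := by
    rw [← CFC.rpow_add hA.isUnit]; ring_nf
  have e1' : A ^ (p * (1 / 2)) = A ^ ((p - 1) * (1 / 2)) * A ^ (1 / 2 : ℝ) := by
    rw [← CFC.rpow_add hA.isUnit]; ring_nf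
  have e2 : A ^ (p * -(1 / 2)) = A ^ (-(1 / 2) : ℝ) * A ^ ((p - 1) * -(1 / 2)) := by
    rw [← CFC.rpow_add hA.isUnit]; ring_nf
  have e2' : A ^ (p * -(1 / 2)) = A ^ ((p - 1) * -(1 / 2)) * A ^ (-(1 / 2) : ℝ) := by
    rw [← CFC.rpow_add hA.isUnit]; ring_nf
  have e3 : A ^ (p * -(1 / 2)) * B * A ^ (p * -(1 / 2)) =
      A ^ ((p - 1) * -(1 / 2)) * (A ^ (-(1 / 2) : ℝ) * B * A ^ (-(1 / 2) : ℝ)) *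
        A ^ ((p - 1) * -(1 / 2)) := by
    conv_lhs => enter [1, 1]; rw [e2']
    rw [e2]
    simp only [mul_assoc]
  rw [operatorMean_eq, operatorMean_eq, hA.rpow_rpow, hA.rpow_rpow, hA.rpow_rpow, hA.rpow_rpow, e3]
  conv_lhs => enter [1, 1]; rw [e1]
  rw [e1']
  simp only [mul_assoc]

end Mean

/-! ### Joint monotonicity and the Ando–Hiai estimate. -/

section AndoHiai

variable {H : Type u} [NormedAddCommGroup H] [InnerProductSpace ℂ H] [CompleteSpace H]

/-- Operator means are jointly monotone. -/
theorem operatorMean_mono {h : ℝ → ℝ} (hh : IsOperatorMonotone.{u} h)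
    (hpos : ∀ t, 0 < t → 0 < h t) {A₁ A₂ B₁ B₂ : H →L[ℂ] H} (hA₁ : IsStrictlyPositive A₁)
    (hB₁ : IsStrictlyPositive B₁) (hA : A₁ ≤ A₂) (hB : B₁ ≤ B₂) :
    operatorMean h A₁ B₁ ≤ operatorMean h A₂ B₂ := by
  have hA₂ := hA₁.of_le hA
  have hB₂ := hB₁.of_le hB
  have stepB : operatorMean h A₁ B₁ ≤ operatorMean h A₁ B₂ :=
    conjugate_le_conjugate_of_isSelfAdjoint
      (hh.2 H _ _ (hA₁.rpow_conjugate hB₁ _)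
        (conjugate_le_conjugate_of_isSelfAdjoint hB (isSelfAdjoint_rpow A₁ _)))
      (isSelfAdjoint_rpow A₁ _)
  refine stepB.trans ?_
  rw [operatorMean_eq, operatorMean_eq]
  set a := A₁ ^ (1 / 2 : ℝ) with ha
  set a' := A₁ ^ (-(1 / 2) : ℝ) with ha'
  set b := A₂ ^ (1 / 2 : ℝ) with hb
  set b' := A₂ ^ (-(1 / 2) : ℝ) with hb'
  have haa : a * a' = 1 := CFC.rpow_mul_rpow_neg _ hA₁
  have haa' : a' * a = 1 := CFC.rpow_neg_mul_rpow _ hA₁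
  have hbb : b * b' = 1 := CFC.rpow_mul_rpow_neg _ hA₂
  have hbb' : b' * b = 1 := CFC.rpow_neg_mul_rpow _ hA₂
  have hstar : star (a * b') = b' * a := by
    rw [star_mul, (isSelfAdjoint_rpow A₁ _).star_eq, (isSelfAdjoint_rpow A₂ _).star_eq]
  have hK : IsUnit (a * b') := (hA₁.rpow A₁ _).isUnit.mul (hA₂.rpow A₂ _).isUnit
  have hK1 : star (a * b') * (a * b') ≤ 1 := by
    have h1 : star (a * b') * (a * b') = b' * A₁ * b' := by
      rw [hstar, ← hA₁.rpow_half_mul_rpow_half]; simp only [mul_assoc, ← ha]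
    have h2 : b' * A₂ * b' = 1 := by
      rw [← hA₂.rpow_half_mul_rpow_half, ← hb, ← mul_assoc, hbb', one_mul, hbb]
    rw [h1, ← h2]
    exact conjugate_le_conjugate_of_isSelfAdjoint hA (isSelfAdjoint_rpow A₂ _)
  -- Monotonicity in the first argument: `A₁ ≤ A₂` makes `A₁^(1/2) A₂^(-1/2)` a contraction, so
  -- Hansen's inequality applies.
  have key := hh.conjugate_cfc_le hpos (hA₁.rpow_conjugate hB₂ (-(1 / 2))) hK hK1
  rw [← ha', hstar] at key
  have e1 : b' * a * (a' * B₂ * a') * (a * b') = b' * B₂ * b' := by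
    calc _ = b' * (a * a') * B₂ * (a' * a) * b' := by simp only [mul_assoc]
      _ = _ := by rw [haa, haa', mul_one, mul_one]
  rw [e1] at key
  have := conjugate_le_conjugate_of_isSelfAdjoint key (isSelfAdjoint_rpow A₂ (1 / 2))
  rw [← hb] at this
  have e2 : ∀ T, b * (b' * a * T * (a * b')) * b = a * T * a := fun T => by
    calc _ = (b * b') * a * T * a * (b' * b) := by simp only [mul_assoc]
      _ = _ := by rw [hbb, hbb', one_mul, mul_one]
  rwa [e2] at this

/-- A form of the Ando–Hiai inequality for power monotone decreasing functions. -/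
theorem operatorMean_rpow_rpow_le {h : ℝ → ℝ} (hh : IsOperatorMonotone.{u} h)
    (hpos : ∀ t, 0 < t → 0 < h t) (hpmd : IsPMD h) {A B : H →L[ℂ] H}
    (hA : IsStrictlyPositive A) (hB : IsStrictlyPositive B) {c : ℝ} (hc : 0 < c)
    (hle : operatorMean h A B ≤ algebraMap ℝ (H →L[ℂ] H) c) {p : ℝ} (hp : p ∈ Icc (1 : ℝ) 2) :
    operatorMean h (A ^ p) (B ^ p) ≤ c ^ (p - 1) • operatorMean h A B := by
  -- The bound `p ≤ 2` serves to make `p - 1` a Löwner–Heinz exponent.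
  have hp1 : p - 1 ∈ Icc (0 : ℝ) 1 := ⟨by linarith [hp.1], by linarith [hp.2]⟩
  have hC := hA.rpow_conjugate hB (-(1 / 2))
  rw [operatorMean_eq] at hle
  rw [operatorMean_eq h A B]
  set a := A ^ (1 / 2 : ℝ) with ha
  set a' := A ^ (-(1 / 2) : ℝ) with ha'
  set C := a' * B * a' with hCdef
  have hs := hC.spectrum_subset_Ioi
  have haa : a * a' = 1 := CFC.rpow_mul_rpow_neg _ hA
  have haa' : a' * a = 1 := CFC.rpow_neg_mul_rpow _ hA
  have hasa : IsSelfAdjoint a := isSelfAdjoint_rpow A _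
  have hasa' : IsSelfAdjoint a' := isSelfAdjoint_rpow A _
  set w : ℝ → ℝ := fun t => (h t / c) ^ (-1 : ℝ) with hw
  have hhc : ∀ t, 0 < t → 0 < h t / c := fun t ht => div_pos (hpos t ht) hc
  have hw0 : ∀ t, 0 < t → 0 < w t := fun t ht => Real.rpow_pos_of_pos (hhc t ht) _
  have hhcc : ContinuousOn (fun t => h t / c) (Ioi 0) := hh.1.div_const c
  have hwc : ContinuousOn w (Ioi 0) := hhcc.rpow_const fun t ht => Or.inl (hhc t ht).ne'
  set u : ℝ → ℝ := fun t => w t ^ (p - 1) with hu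
  have hu0 : ∀ t, 0 < t → 0 < u t := fun t ht => Real.rpow_pos_of_pos (hw0 t ht) _
  have huc : ContinuousOn u (Ioi 0) := hwc.rpow_const fun t ht => Or.inl (hw0 t ht).ne'
  set v : ℝ → ℝ := fun t => t ^ p * u t with hv
  have hv0 : ∀ t, 0 < t → 0 < v t := fun t ht => mul_pos (Real.rpow_pos_of_pos ht _) (hu0 t ht)
  have hvc : ContinuousOn v (Ioi 0) := (continuousOn_rpow_Ioi p).mul huc
  -- `A ≤ c h(C)⁻¹`
  have hAw : A ≤ cfc w C := by
    have h1 : cfc (fun t => h t / c) C ≤ A ^ (-1 : ℝ) := by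
      have h2 := conjugate_le_conjugate_of_isSelfAdjoint hle hasa'
      have e1 : a' * (a * cfc h C * a) * a' = cfc h C := by
        calc _ = (a' * a) * cfc h C * (a * a') := by simp only [mul_assoc]
          _ = _ := by rw [haa, haa', one_mul, mul_one]
      have e2 : a' * algebraMap ℝ (H →L[ℂ] H) c * a' = c • A ^ (-1 : ℝ) := by
        rw [← Algebra.commutes, mul_assoc, ha', ← CFC.rpow_add hA.isUnit, ← Algebra.smul_def]
        norm_num
      rw [e1, e2] at h2
      have e3 : cfc (fun t => h t / c) C = c⁻¹ • cfc h C := by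
        rw [← cfc_smul c⁻¹ h C (hh.1.mono hs)]
        refine cfc_congr fun t _ => ?_
        simp only [smul_eq_mul]; ring
      rw [e3]
      have := smul_le_smul_of_nonneg_left h2 (inv_nonneg.2 hc.le)
      rwa [smul_smul, inv_mul_cancel₀ hc.ne', one_smul] at this
    have h3 := CStarAlgebra.rpow_neg_one_le_rpow_neg_one h1 (isStrictlyPositive_cfc hC hhcc hhc)
    rw [hA.rpow_rpow, CFC.cfc_rpow (fun t ht => hhc t (hs ht)) (hhcc.mono hs) hC.isSelfAdjoint]
      at h3
    norm_num only at h3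
    rwa [CFC.rpow_one A hA.nonneg] at h3
  have hAu : A ^ (p - 1) ≤ cfc u C := by
    have := CFC.rpow_le_rpow hp1 hAw
    rwa [CFC.cfc_rpow (fun t ht => hw0 t (hs ht)) (hwc.mono hs) hC.isSelfAdjoint] at this
  -- `A^{-1/2} B^p A^{-1/2} ≤ C^p (c h(C)⁻¹)^{p-1}`
  have hBv : a' * B ^ p * a' ≤ cfc v C := by
    set r := C ^ (1 / 2 : ℝ) with hr
    have hrr : r * r = C := hC.rpow_half_mul_rpow_half
    have hrsa : IsSelfAdjoint r := isSelfAdjoint_rpow C _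
    -- `Z = A^(1/2) C^(1/2)` satisfies `Z Z* = B` and `Z* Z = C^(1/2) A C^(1/2)`, so `B^p = Z (Z*
    -- Z)^(p-1) Z*`: only a power in `[0,1]` remains to be compared.
    have hZ : IsUnit (a * r) := (hA.rpow A _).isUnit.mul (hC.rpow C _).isUnit
    have hZs : star (a * r) = r * a := by rw [star_mul, hasa.star_eq, hrsa.star_eq]
    have hZZ : (a * r) * star (a * r) = B := by
      calc _ = a * (r * r) * a := by rw [hZs]; simp only [mul_assoc]
        _ = (a * a') * B * (a' * a) := by rw [hrr, hCdef]; simp only [mul_assoc]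
        _ = B := by rw [haa, haa', one_mul, mul_one]
    have hZZ' : star (a * r) * (a * r) = r * A * r := by
      rw [hZs, ← hA.rpow_half_mul_rpow_half]; simp only [mul_assoc, ← ha]
    have hBp : a' * B ^ p * a' = r * (r * A * r) ^ (p - 1) * r := by
      have h1 := mul_star_self_rpow_mul hZ (p - 1)
      rw [hZZ, hZZ'] at h1
      have h2 : B ^ p = a * r * (r * A * r) ^ (p - 1) * (r * a) := by
        rw [← h1, mul_assoc, ← hZs, hZZ]
        nth_rw 3 [← CFC.rpow_one B hB.nonneg]
        rw [← CFC.rpow_add hB.isUnit, sub_add_cancel]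
      calc _ = (a' * a) * r * (r * A * r) ^ (p - 1) * r * (a * a') := by
            rw [h2]; simp only [mul_assoc]
        _ = _ := by rw [haa, haa', one_mul, mul_one]
    have h3 : r * (r * A * r) ^ (p - 1) * r ≤ r * (r * cfc w C * r) ^ (p - 1) * r :=
      conjugate_le_conjugate_of_isSelfAdjoint
        (CFC.rpow_le_rpow hp1 (conjugate_le_conjugate_of_isSelfAdjoint hAw hrsa)) hrsa
    have h4 : r * cfc w C * r = cfc (fun t => t * w t) C :=
      hC.rpow_half_conjugate_cfc (hwc.mono hs)
    have htw : ContinuousOn (fun t => t * w t) (spectrum ℝ C) := continuousOn_id.mul (hwc.mono hs)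
    have htw0 : ∀ t ∈ spectrum ℝ C, 0 < t * w t := fun t ht => mul_pos (hs ht) (hw0 t (hs ht))
    have htwp : ContinuousOn (fun t => (t * w t) ^ (p - 1)) (spectrum ℝ C) :=
      htw.rpow_const fun t ht => Or.inl (htw0 t ht).ne'
    have h5 : r * (r * cfc w C * r) ^ (p - 1) * r = cfc v C := by
      rw [h4, CFC.cfc_rpow htw0 htw hC.isSelfAdjoint,
        hC.rpow_half_conjugate_cfc htwp]
      refine cfc_congr fun t ht => ?_
      have h0 : 0 < t := hs ht
      simp only [hv, hu]
      rw [Real.mul_rpow h0.le (hw0 t h0).le, ← mul_assoc]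
      congr 1
      nth_rw 1 [← Real.rpow_one t]
      rw [← Real.rpow_add h0]
      ring_nf
    rw [hBp, ← h5]
    exact h3
  have hBpos : IsStrictlyPositive (a' * B ^ p * a') := hA.rpow_conjugate (hB.rpow B p) _
  have hmono := operatorMean_mono hh hpos (hA.rpow A (p - 1)) hBpos hAu hBv
  rw [operatorMean_cfc_cfc hh.1 huc hu0 hvc hv0 hC] at hmono
  -- Here `v / u = t^p`, and pmd gives `u h(t^p) ≤ (c / h)^(p-1) h^p = c^(p-1) h`.
  have hfin : cfc (fun t => u t * h (v t / u t)) C ≤ c ^ (p - 1) • cfc h C := by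
    have hvu : ∀ t ∈ spectrum ℝ C, v t / u t = t ^ p := fun t ht =>
      mul_div_cancel_right₀ _ (hu0 t (hs ht)).ne'
    rw [← cfc_smul _ h C (hh.1.mono hs), cfc_congr (g := fun t => u t * h (t ^ p))
      (fun t ht => by simp only [hvu t ht])]
    refine cfc_mono (fun t ht => ?_) ?_ (by exact (hh.1.mono hs).const_smul (c ^ (p - 1)))
    · have h0 : 0 < t := hs ht
      have hh0 := hpos t h0
      calc u t * h (t ^ p) ≤ u t * h t ^ p :=
            mul_le_mul_of_nonneg_left (hpmd t p h0 hp.1) (hu0 t h0).le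
        _ = c ^ (p - 1) • h t := by
            simp only [hu, hw, smul_eq_mul]
            rw [Real.rpow_neg_one, inv_div, Real.div_rpow hc.le hh0.le, div_mul_eq_mul_div,
              mul_div_assoc, ← Real.rpow_sub hh0]
            norm_num
    · exact (huc.mono hs).mul (hh.1.comp ((continuousOn_rpow_Ioi p).mono hs)
        fun t ht => Real.rpow_pos_of_pos (hs ht) _)
  have h6 := conjugate_le_conjugate_of_isSelfAdjoint (hmono.trans hfin) hasa
  have h7 : a * (c ^ (p - 1) • cfc h C) * a = c ^ (p - 1) • (a * cfc h C * a) := by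
    rw [mul_smul_comm, smul_mul_assoc]
  rw [h7] at h6
  rw [← operatorMean_rpow_left h hA] at h6
  exact h6

end AndoHiai

/-! ### The derivative of the mean at exponent zero. -/

section Derivative

open Filter Topology

variable {H : Type*} [NormedAddCommGroup H] [InnerProductSpace ℂ H] [CompleteSpace H]

theorem IsStrictlyPositive.rpow_eq_exp_smul_log {A : H →L[ℂ] H} (hA : IsStrictlyPositive A)
    (x : ℝ) : A ^ x = NormedSpace.exp (x • CFC.log A) := by
  have hlog : ContinuousOn Real.log (spectrum ℝ A) :=
    Real.continuousOn_log.mono fun t ht => (hA.spectrum_pos ht).ne'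
  have hxlog : ContinuousOn (fun t => x • Real.log t) (spectrum ℝ A) := hlog.const_smul x
  rw [CFC.log, ← cfc_smul x Real.log A hlog,
    ← CFC.real_exp_eq_normedSpace_exp (cfc_predicate _ A),
    ← cfc_comp' Real.exp _ A Real.continuous_exp.continuousOn hxlog hA.isSelfAdjoint,
    CFC.rpow_eq_cfc_real hA.nonneg]
  refine cfc_congr fun t ht => ?_
  simp only [smul_eq_mul]
  rw [Real.rpow_def_of_pos (hA.spectrum_pos ht), mul_comm]

theorem IsStrictlyPositive.hasDerivAt_rpow_mul_zero {A : H →L[ℂ] H} (hA : IsStrictlyPositive A)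
    (r : ℝ) : HasDerivAt (fun x : ℝ => A ^ (x * r)) (r • CFC.log A) 0 := by
  have h := hasDerivAt_exp_smul_const (𝕂 := ℝ) (r • CFC.log A) (0 : ℝ)
  rw [zero_smul, NormedSpace.exp_zero, one_mul] at h
  refine h.congr_of_eventuallyEq (Eventually.of_forall fun x => ?_)
  simp only
  rw [hA.rpow_eq_exp_smul_log, mul_smul]

/-- The derivative of a functional calculus at the identity operator. -/
theorem HasDerivAt.cfc_of_eq_one {h : ℝ → ℝ} {α : ℝ} (hc : ContinuousOn h (Ioi 0))
    (hd : HasDerivAt h α 1) {Y : ℝ → H →L[ℂ] H} {Y' : H →L[ℂ] H} {x₀ : ℝ}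
    (hY : HasDerivAt Y Y' x₀) (hY1 : Y x₀ = 1) (hpos : ∀ x, IsStrictlyPositive (Y x)) :
    HasDerivAt (fun x => cfc h (Y x)) (α • Y') x₀ := by
  -- The spectrum of `Y x` lies within `‖Y x - 1‖` of `1`, so the scalar first-order error bound at
  -- `1` passes to the operator norm.
  have hE : (fun x => cfc h (Y x) - cfc h (Y x₀) - α • (Y x - Y x₀)) =o[𝓝 x₀]
      fun x => Y x - Y x₀ := by
    refine Asymptotics.IsLittleO.of_bound fun ε hε => ?_
    have h1 := (hasDerivAt_iff_isLittleO.1 hd).bound hε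
    obtain ⟨δ, hδ, hball⟩ := Metric.eventually_nhds_iff.1 h1
    have hcont := hY.continuousAt
    filter_upwards [Metric.tendsto_nhds.1 hcont δ hδ] with x hx
    rw [dist_eq_norm, hY1] at hx
    rw [hY1]
    have hs := (hpos x).spectrum_subset_Ioi
    have hsa := (hpos x).isSelfAdjoint
    have hhs := hc.mono hs
    have hsub : cfc (fun t : ℝ => t - 1) (Y x) = Y x - 1 := by
      rw [cfc_sub (fun t : ℝ => t) (fun _ => 1) (Y x), cfc_id' ℝ (Y x), cfc_const_one ℝ (Y x)]
    have hE1 : cfc (fun t => h t - h 1 - (t - 1) • α) (Y x) =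
        cfc h (Y x) - cfc h 1 - α • (Y x - 1) := by
      rw [cfc_sub (fun t => h t - h 1) (fun t => (t - 1) • α) (Y x) (hhs.sub continuousOn_const)
        (by fun_prop), cfc_sub h (fun _ => h 1) (Y x) hhs continuousOn_const,
        cfc_const _ _ hsa, cfc_apply_one, ← hsub, ← cfc_smul α (fun t : ℝ => t - 1) (Y x)]
      congr 2
      ext t
      simp [mul_comm]
    rw [← hE1]
    refine norm_cfc_le (by positivity) fun t ht => ?_
    have hnt : ‖t - 1‖ ≤ ‖Y x - 1‖ := by
      rw [← hsub]
      exact norm_apply_le_norm_cfc (fun t : ℝ => t - 1) (Y x) ht (by fun_prop) hsa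
    exact (hball (by rw [dist_eq_norm]; exact hnt.trans_lt hx)).trans
      (mul_le_mul_of_nonneg_left hnt hε.le)
  have hO : (fun x => Y x - Y x₀) =O[𝓝 x₀] fun x => x - x₀ := hY.isBigO_sub
  rw [hasDerivAt_iff_isLittleO]
  have h2 := (hasDerivAt_iff_isLittleO.1 hY).const_smul_left α
  refine ((hE.trans_isBigO hO).add h2).congr_left fun x => ?_
  simp only [Pi.smul_apply]
  module

theorem operatorMean_rpow_zero {h : ℝ → ℝ} (h1 : h 1 = 1) {A B : H →L[ℂ] H}
    (hA : IsStrictlyPositive A) (hB : IsStrictlyPositive B) :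
    operatorMean h (A ^ (0 : ℝ)) (B ^ (0 : ℝ)) = 1 := by
  simp [operatorMean_eq, CFC.rpow_zero A hA.nonneg, CFC.rpow_zero B hB.nonneg, h1]

/-- All factors equal `1` at `x = 0`, so noncommutativity is invisible to first order: the outer
factors contribute `log A`, the inner one `α (log B - log A)`. -/
theorem hasDerivAt_operatorMean_rpow {h : ℝ → ℝ} {α : ℝ} (hc : ContinuousOn h (Ioi 0))
    (hh1 : h 1 = 1) (hd : HasDerivAt h α 1) {A B : H →L[ℂ] H}
    (hA : IsStrictlyPositive A) (hB : IsStrictlyPositive B) :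
    HasDerivAt (fun x : ℝ => operatorMean h (A ^ x) (B ^ x))
      ((1 - α) • CFC.log A + α • CFC.log B) 0 := by
  have hA0 : A ^ (0 : ℝ) = 1 := CFC.rpow_zero A hA.nonneg
  have hB0 : B ^ (0 : ℝ) = 1 := CFC.rpow_zero B hB.nonneg
  have dA := hA.hasDerivAt_rpow_mul_zero (1 / 2)
  have dA' := hA.hasDerivAt_rpow_mul_zero (-(1 / 2))
  have dB := hB.hasDerivAt_rpow_mul_zero 1
  simp only [mul_one, one_smul] at dB
  have dY := (dA'.mul dB).mul dA'
  have dh := HasDerivAt.cfc_of_eq_one hc hd dY (by simp [hA0, hB0])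
    fun x => hA.rpow_conjugate (hB.rpow B x) _
  have d := (dA.mul dh).mul dA
  simp only [Pi.mul_apply, zero_mul, hA0, hB0, mul_one, one_mul, cfc_apply_one, hh1, map_one] at d
  refine (d.congr_of_eventuallyEq (Eventually.of_forall fun x => ?_)).congr_deriv ?_
  · simp only [operatorMean_eq, hA.rpow_rpow, Pi.mul_apply]
  · module

end Derivative

/-! ### From the logarithmic condition to monotonicity. -/

section Decreasing

open Filter Topology

variable {H : Type u} [NormedAddCommGroup H] [InnerProductSpace ℂ H] [CompleteSpace H]

theorem rpow_mem_PMDOne {α : ℝ} (hα : α ∈ Ioo (0 : ℝ) 1) :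
    (fun t : ℝ => t ^ α) ∈ PMDOne.{u} α := by
  refine ⟨⟨⟨continuousOn_rpow_Ioi α, ?_⟩, fun t ht => Real.rpow_pos_of_pos ht α,
    Real.one_rpow α⟩, ?_, ?_⟩
  · intro K _ _ _ A B hA hAB
    rw [← CFC.rpow_eq_cfc_real hA.nonneg, ← CFC.rpow_eq_cfc_real (hA.of_le hAB).nonneg]
    exact CFC.rpow_le_rpow ⟨hα.1.le, hα.2.le⟩ hAB
  · intro t p ht _
    change (t ^ p) ^ α ≤ (t ^ α) ^ p
    rw [← Real.rpow_mul ht.le, ← Real.rpow_mul ht.le, mul_comm]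
  · simpa using Real.hasDerivAt_rpow_const (x := 1) (p := α) (Or.inl one_ne_zero)

theorem operatorMean_rpow_mul_le {h : ℝ → ℝ} (hh : IsOperatorMonotone.{u} h)
    (hpos : ∀ t, 0 < t → 0 < h t) (hpmd : IsPMD h) {A B : H →L[ℂ] H}
    (hA : IsStrictlyPositive A) (hB : IsStrictlyPositive B) {c x p : ℝ} (hc : 0 < c)
    (hle : operatorMean h (A ^ x) (B ^ x) ≤ algebraMap ℝ (H →L[ℂ] H) c)
    (hp : p ∈ Icc (1 : ℝ) 2) :
    operatorMean h (A ^ (x * p)) (B ^ (x * p)) ≤ c ^ (p - 1) • operatorMean h (A ^ x) (B ^ x) := by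
  have := operatorMean_rpow_rpow_le hh hpos hpmd (hA.rpow A x) (hB.rpow B x) hc hle hp
  rwa [hA.rpow_rpow, hB.rpow_rpow] at this

/-- First-order expansion with remainder at most `ε x`, followed by `1 + ε x ≤ exp (ε x)`. The
exponential form is the one that doubling preserves. -/
theorem HasDerivAt.exists_le_algebraMap_exp {F : ℝ → H →L[ℂ] H} {L : H →L[ℂ] H}
    (hF : HasDerivAt F L 0) (hF0 : F 0 = 1) (hFsa : ∀ x, IsSelfAdjoint (F x)) (hL : L ≤ 0)
    {ε : ℝ} (hε : 0 < ε) :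
    ∃ δ > 0, ∀ x : ℝ, 0 < x → x < δ → F x ≤ algebraMap ℝ (H →L[ℂ] H) (Real.exp (ε * x)) := by
  obtain ⟨δ, hδ, hball⟩ := Metric.eventually_nhds_iff.1
    ((hasDerivAt_iff_isLittleO.1 hF).bound hε)
  use δ, hδ
  intro x hx hxδ
  have hb := hball (y := x) (by rwa [Real.dist_eq, sub_zero, abs_of_pos hx])
  rw [hF0, sub_zero, Real.norm_of_nonneg hx.le] at hb
  have hLsa : IsSelfAdjoint L := by
    simpa using (neg_nonneg.2 hL).isSelfAdjoint.neg
  have hxL : IsSelfAdjoint (x • L) := (IsSelfAdjoint.all x).smul hLsa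
  have hsa : IsSelfAdjoint (F x - 1 - x • L) :=
    ((hFsa x).sub (IsSelfAdjoint.one _)).sub hxL
  have h2 : F x - 1 - x • L ≤ algebraMap ℝ (H →L[ℂ] H) (ε * x) :=
    le_trans (IsSelfAdjoint.le_algebraMap_norm_self hsa) (algebraMap_mono (H →L[ℂ] H) hb)
  have h3 : F x ≤ algebraMap ℝ (H →L[ℂ] H) (ε * x) + 1 := by
    have h4 : x • L ≤ 0 := smul_nonpos_of_nonneg_of_nonpos hx.le hL
    have h5 : F x = (F x - 1 - x • L) + 1 + x • L := by abel
    rw [h5, ← add_zero (algebraMap ℝ (H →L[ℂ] H) (ε * x) + 1)]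
    exact add_le_add (add_le_add h2 le_rfl) h4
  have h6 : algebraMap ℝ (H →L[ℂ] H) (ε * x) + 1 ≤
      algebraMap ℝ (H →L[ℂ] H) (Real.exp (ε * x)) := by
    have := algebraMap_mono (H →L[ℂ] H) (Real.add_one_le_exp (ε * x))
    rwa [map_add, map_one] at this
  exact le_trans h3 h6

/-- If the logarithmic mean condition holds, the means of all powers are contractions. -/
theorem operatorMean_rpow_le_one {h : ℝ → ℝ} {α : ℝ} (hh : IsOperatorMonotone.{u} h)
    (hpos : ∀ t, 0 < t → 0 < h t) (h1 : h 1 = 1) (hpmd : IsPMD h) (hd : HasDerivAt h α 1)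
    {A B : H →L[ℂ] H} (hA : IsStrictlyPositive A) (hB : IsStrictlyPositive B)
    (hlog : (1 - α) • CFC.log A + α • CFC.log B ≤ 0) {y : ℝ} (hy : 0 < y) :
    operatorMean h (A ^ y) (B ^ y) ≤ 1 := by
  set F : ℝ → H →L[ℂ] H := fun x => operatorMean h (A ^ x) (B ^ x) with hF
  have hF0 : F 0 = 1 := operatorMean_rpow_zero h1 hA hB
  have hFsa : ∀ x, IsSelfAdjoint (F x) := fun x =>
    (isStrictlyPositive_operatorMean hh.1 hpos (hA.rpow A x) (hB.rpow B x)).isSelfAdjoint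
  have hder := hasDerivAt_operatorMean_rpow hh.1 h1 hd hA hB
  have step : ∀ ε : ℝ, 0 < ε → F y ≤ algebraMap ℝ (H →L[ℂ] H) (Real.exp (ε * y)) := by
    intro ε hε
    obtain ⟨δ, hδ, small⟩ := hder.exists_le_algebraMap_exp hF0 hFsa hlog hε
    -- Doubling squares the bound, `exp (ε x / 2) ^ 2 = exp (ε x)`, so the rate `ε` does not
    -- deteriorate with `n`.
    have double : ∀ (n : ℕ) (x : ℝ), 0 < x → x < δ * 2 ^ n →
        F x ≤ algebraMap ℝ (H →L[ℂ] H) (Real.exp (ε * x)) := by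
      intro n
      induction n with
      | zero => intro x hx hxδ; exact small x hx (by simpa using hxδ)
      | succ n ih =>
        intro x hx hxδ
        have hhalf := ih (x / 2) (by positivity) (by rw [pow_succ] at hxδ; linarith)
        have h5 := operatorMean_rpow_mul_le hh hpos hpmd hA hB (Real.exp_pos _) hhalf
          (p := 2) ⟨by norm_num, le_rfl⟩
        rw [div_mul_cancel₀ x two_ne_zero] at h5
        refine h5.trans ?_
        refine (smul_le_smul_of_nonneg_left hhalf (Real.rpow_nonneg (Real.exp_pos _).le _)).trans ?_
        rw [Algebra.algebraMap_eq_smul_one, Algebra.algebraMap_eq_smul_one, smul_smul,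
          ← Real.exp_mul, ← Real.exp_add]
        ring_nf
        exact le_rfl
    obtain ⟨n, hn⟩ := pow_unbounded_of_one_lt (y / δ) (one_lt_two (α := ℝ))
    exact double n y hy (by rw [div_lt_iff₀ hδ] at hn; linarith)
  have hlim : Tendsto (fun ε : ℝ => algebraMap ℝ (H →L[ℂ] H) (Real.exp (ε * y))) (𝓝[>] 0)
      (𝓝 1) := by
    have : Continuous fun ε : ℝ => algebraMap ℝ (H →L[ℂ] H) (Real.exp (ε * y)) := by fun_prop
    have h6 := this.tendsto 0
    rw [zero_mul, Real.exp_zero, map_one] at h6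
    exact h6.mono_left nhdsWithin_le_nhds
  refine ge_of_tendsto hlim ?_
  filter_upwards [self_mem_nhdsWithin] with ε hε using step ε hε

theorem isDecreasingIntoPositive_operatorMean_rpow {h : ℝ → ℝ} (hh : IsOperatorMonotone.{u} h)
    (hpos : ∀ t, 0 < t → 0 < h t) (h1 : h 1 = 1) (hpmd : IsPMD h)
    {A B : H →L[ℂ] H} (hA : IsStrictlyPositive A) (hB : IsStrictlyPositive B)
    (hle : ∀ x : ℝ, 0 < x → operatorMean h (A ^ x) (B ^ x) ≤ 1) :
    IsDecreasingIntoPositive (fun x : ℝ => operatorMean h (A ^ x) (B ^ x)) := by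
  refine ⟨fun x _ => isStrictlyPositive_operatorMean hh.1 hpos (hA.rpow A x) (hB.rpow B x), ?_⟩
  -- Ratios beyond `2` are reached by repeatedly splitting off a factor `2`.
  have iter : ∀ (n : ℕ) (x p : ℝ), 0 < x → 1 ≤ p → p ≤ 2 ^ n →
      operatorMean h (A ^ (x * p)) (B ^ (x * p)) ≤ operatorMean h (A ^ x) (B ^ x) := by
    have base : ∀ x p : ℝ, 0 < x → p ∈ Icc (1 : ℝ) 2 →
        operatorMean h (A ^ (x * p)) (B ^ (x * p)) ≤ operatorMean h (A ^ x) (B ^ x) := by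
      intro x p hx hp
      have := operatorMean_rpow_mul_le hh hpos hpmd hA hB one_pos
        (by rw [map_one]; exact hle x hx) hp
      rwa [Real.one_rpow, one_smul] at this
    intro n
    induction n with
    | zero => intro x p hx hp hpn; exact base x p hx ⟨hp, by norm_num at hpn; linarith⟩
    | succ n ih =>
      intro x p hx hp hpn
      rcases le_or_gt p 2 with hp2 | hp2
      · exact base x p hx ⟨hp, hp2⟩
      · have h2 := base (x * (p / 2)) 2 (by positivity) ⟨by norm_num, le_rfl⟩
        rw [mul_assoc, div_mul_cancel₀ p two_ne_zero] at h2
        exact h2.trans (ih x (p / 2) hx (by linarith) (by rw [pow_succ] at hpn; linarith))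
  intro x hx y hy hxy
  -- No rescaling starts from `0`; there the claim is `F y ≤ 1 = F 0`.
  rcases (mem_Ici.1 hx).eq_or_lt with rfl | hx0
  · simp only [operatorMean_rpow_zero h1 hA hB]
    rcases (mem_Ici.1 hy).eq_or_lt with rfl | hy0
    · rw [operatorMean_rpow_zero h1 hA hB]
    · exact hle y hy0
  · obtain ⟨n, hn⟩ := pow_unbounded_of_one_lt (y / x) (one_lt_two (α := ℝ))
    have := iter n x (y / x) hx0 ((one_le_div hx0).2 hxy) hn.le
    rwa [mul_div_cancel₀ y hx0.ne'] at this

end Decreasing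

/-! ### The equivalences. -/

theorem proposition5p9 {H : Type u} [NormedAddCommGroup H] [InnerProductSpace ℂ H]
    [CompleteSpace H] (α : ℝ) (hα : α ∈ Ioo (0 : ℝ) 1) (A B : H →L[ℂ] H)
    (hA : IsStrictlyPositive A) (hB : IsStrictlyPositive B) :
    List.TFAE
      [(1 - α) • CFC.log A + α • CFC.log B ≤ 0,
       ∀ h ∈ PMDOne.{u} α,
         IsDecreasingIntoPositive (fun x : ℝ => operatorMean h (A ^ x) (B ^ x)),
       ∃ h ∈ PMDOne.{u} α,
         IsDecreasingIntoPositive (fun x : ℝ => operatorMean h (A ^ x) (B ^ x)),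
       IsDecreasingIntoPositive (fun x : ℝ => weightedGeometricMean α (A ^ x) (B ^ x))] := by
  have hgeom : (fun x : ℝ => weightedGeometricMean α (A ^ x) (B ^ x)) =
      fun x : ℝ => operatorMean (fun t => t ^ α) (A ^ x) (B ^ x) := funext fun x =>
    weightedGeometricMean_eq_operatorMean α (hA.rpow A x) (hB.rpow B x)
  rw [hgeom]
  tfae_have 1 → 2 := fun hlog h ⟨⟨hh, hpos, h1⟩, hpmd, hd⟩ =>
    isDecreasingIntoPositive_operatorMean_rpow hh hpos h1 hpmd hA hB fun _ hy =>
      operatorMean_rpow_le_one hh hpos h1 hpmd hd hA hB hlog hy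
  tfae_have 2 → 4 := fun h => h _ (rpow_mem_PMDOne hα)
  tfae_have 4 → 3 := fun h => ⟨_, rpow_mem_PMDOne hα, h⟩
  tfae_have 3 → 1 := by
    rintro ⟨h, ⟨⟨hh, hpos, h1⟩, hpmd, hd⟩, -, hanti⟩
    -- The derivative is a limit of right difference quotients, all nonpositive for a decreasing
    -- map.
    have lim := (hasDerivAt_operatorMean_rpow hh.1 h1 hd hA hB).tendsto_slope_zero_right
    refine le_of_tendsto lim ?_
    filter_upwards [self_mem_nhdsWithin] with x hx
    rw [mem_Ioi] at hx
    refine smul_nonpos_of_nonneg_of_nonpos (inv_nonneg.2 hx.le) (sub_nonpos.2 ?_)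
    rw [zero_add]
    exact hanti (mem_Ici.2 le_rfl) (mem_Ici.2 hx.le) hx.le
  tfae_finish
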